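/- Let $d\ge 1$, let $\|\cdot\|$ be a norm on $\mathbb R^d$ and let $\Theta_+^{d-1}=\{\omega\in\mathbb R_+^d:\|\omega\|=1\}$, where $\mathbb R_+=[0,\infty)$. For $\alpha>0$ let $\nu_\alpha$ be the measure on $(0,\infty]$ with ${\rm d}\nu_\alpha(x)=\alpha x^{-\alpha-1}\,{\rm d}x$ (and no mass at $\infty$). Let $\boldsymbol X$ be a random vector in $\mathbb R_+^d$ and $b_n\to\infty$ a sequence. A finite Borel measure $H$ on $\Theta_+^{d-1}$ is called the angular measure of $\boldsymbol X$, with index $\alpha$ and normalising sequence $(b_n)$, if - there is a Radon measure $\nu_{\boldsymbol X}$ on $[0,\infty]^d\setminus\{\boldsymbol 0\}$ (the exponent measure) such that $n\,\mathbb P(\boldsymbol X/b_n\in\cdot)\to\nu_{\boldsymbol X}$ vaguely on $[0,\infty]^d\setminus\{\boldsymbol 0\}$, and $H(C)=\nu_{\boldsymbol X}(\{\boldsymbol x\in\mathbb R_+^d\setminus\{\boldsymbol 0\}:\|\boldsymbol x\|\ge 1,\ \boldsymbol x/\|\boldsymbol x\|\in C\})$ for all Borel sets $C\subseteq\Theta_+^{d-1}$;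 and - $n\,\mathbb P\big((\|\boldsymbol X\|/b_n,\ \boldsymbol X/\|\boldsymbol X\|)\in\cdot\big)\to\nu_\alpha\times H$ vaguely on $(0,\infty]\times\Theta_+^{d-1}$. The vector $\boldsymbol X$ is called multivariate regularly varying with index $\alpha$, written $\boldsymbol X\in{\rm RV}_+^d(\alpha)$, if for every norm on $\mathbb R^d$ it has a non-zero angular measure with index $\alpha$ and some normalising sequence $b_n\to\infty$. **Proposition.** Let $A\in\mathbb R_+^{d\times d}$ have columns $\boldsymbol a_1,\dots,\boldsymbol a_d$, and let $\boldsymbol Z\in{\rm RV}_+^d(\alpha)$, $\alpha>0$, have independent components that are standardised: for every $i\in\{1,\dots,d\}$ and every $z>0$, $n\,\mathbb P(n^{-1/\alpha}Z_i>z)\to z^{-\alpha}$ as $n\to\infty$. Then: 1. If $A\neq 0$, the vector $A\boldsymbol Z$ is multivariate regularly varying with index $\alpha$. 2. For every norm $\|\cdot\|$ on $\mathbb R^d$, the angular measure of $A\boldsymbol Z$ on $\Theta_+^{d-1}$, with index $\alpha$ and normalising sequence $b_n=n^{1/\alpha}$, exists, is unique, and equals $$H_{A\boldsymbol Z}(\cdot)=\sum_{j=1}^d\|\boldsymbol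 a_j\|^\alpha\,\delta_{\boldsymbol a_j/\|\boldsymbol a_j\|}(\cdot),$$ where the terms with $\boldsymbol a_j=\boldsymbol 0$ are read as $0$. (For $A=0$ the angular measure is the zero measure.) -/

import Mathlib

open MeasureTheory ProbabilityTheory Filter Topology
open scoped NNReal ENNReal Matrix

noncomputable section

namespace MRV

/-- Vague convergence of measures on a (locally compact) space: convergence of the integrals of
all continuous compactly supported functions. -/
def VagueTendsto {E : Type*} [TopologicalSpace E] [MeasurableSpace E]
    (μ : ℕ → Measure E) (ν : Measure E) : Prop :=
  ∀ f : E → ℝ, Continuous f → HasCompactSupport f →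
    Tendsto (fun n => ∫ x, f x ∂(μ n)) atTop (𝓝 (∫ x, f x ∂ν))

/-- The punctured compactified orthant `[0, ∞]^d \ {0}`. -/
abbrev Punctured (d : ℕ) : Type := {x : Fin d → ℝ≥0∞ // x ≠ 0}

/-- The half line `(0, ∞]`. -/
abbrev PosExt : Type := {r : ℝ≥0∞ // 0 < r}

/-- `N` is a norm on `ℝ^d` (a seminorm that is definite). -/
def IsNorm {d : ℕ} (N : Seminorm ℝ (Fin d → ℝ)) : Prop := ∀ x, N x = 0 → x = 0

/-- The norm of a vector of the orthant `ℝ_+^d`, as a non-negative real number. -/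
def posNorm {d : ℕ} (N : Seminorm ℝ (Fin d → ℝ)) (x : Fin d → ℝ≥0) : ℝ≥0 :=
  ⟨N (fun i => (x i : ℝ)), apply_nonneg N _⟩

/-- The positive unit sphere `{ω ∈ ℝ_+^d : ‖ω‖ = 1}`. -/
abbrev PosSphere {d : ℕ} (N : Seminorm ℝ (Fin d → ℝ)) : Type :=
  {θ : Fin d → ℝ≥0 // posNorm N θ = 1}

/-- The measure `ν_α` on `(0, ∞]` with `dν_α(x) = α x^(-α-1) dx`, without mass at `∞`. -/
def powerMeasure (α : ℝ) : Measure PosExt :=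
  ((((volume : Measure ℝ).restrict (Set.Ioi 0)).withDensity
    fun x => ENNReal.ofReal (α * x ^ (-α - 1))).map ENNReal.ofReal).comap Subtype.val

/-- `n P(X / b_n ∈ ·)` as a measure on `[0, ∞]^d \ {0}`. -/
def scaledLaw {Ω : Type*} [MeasurableSpace Ω] {d : ℕ} (P : Measure Ω) (X : Ω → Fin d → ℝ≥0)
    (b : ℕ → ℝ≥0) (n : ℕ) : Measure (Punctured d) :=
  (n : ℝ≥0∞) •
    (P.map fun ω => fun i => ((X ω i / b n : ℝ≥0) : ℝ≥0∞)).comap Subtype.val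

/-- `n P((R / b_n, ω) ∈ ·)` as a measure on `(0, ∞] × Θ`, where `R = ‖X‖` and `ω = X / ‖X‖`.
The event `X = 0`, where the angle is undefined, has `R = 0` and does not contribute. -/
def scaledPolarLaw {Ω : Type*} [MeasurableSpace Ω] {d : ℕ} (P : Measure Ω)
    (N : Seminorm ℝ (Fin d → ℝ)) (X : Ω → Fin d → ℝ≥0)
    (b : ℕ → ℝ≥0) (n : ℕ) : Measure (PosExt × PosSphere N) :=
  (n : ℝ≥0∞) •
    (P.map fun ω => (((posNorm N (X ω) / b n : ℝ≥0) : ℝ≥0∞),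
      (posNorm N (X ω))⁻¹ • X ω)).comap (Prod.map Subtype.val Subtype.val)

/-- `ν` is the exponent measure of `X` for the normalising sequence `b`: a Radon measure on
`[0, ∞]^d \ {0}` that is the vague limit of `n P(X / b_n ∈ ·)`. -/
def HasExponentMeasure {Ω : Type*} [MeasurableSpace Ω] {d : ℕ} (P : Measure Ω)
    (X : Ω → Fin d → ℝ≥0) (b : ℕ → ℝ≥0) (ν : Measure (Punctured d)) : Prop :=
  IsFiniteMeasureOnCompacts ν ∧ VagueTendsto (scaledLaw P X b) ν

/-- The set `{x ∈ ℝ_+^d \ {0} : ‖x‖ ≥ 1, x / ‖x‖ ∈ C}`, as a subset of `[0, ∞]^d \ {0}`. -/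
def outerCone {d : ℕ} (N : Seminorm ℝ (Fin d → ℝ)) (C : Set (PosSphere N)) :
    Set (Punctured d) :=
  {x | ∃ y : Fin d → ℝ≥0, (∀ i, x.1 i = (y i : ℝ≥0∞)) ∧ 1 ≤ posNorm N y ∧
    ∃ θ ∈ C, θ.1 = (posNorm N y)⁻¹ • y}

/-- `H` is the angular measure of `X` on the positive unit sphere of `N`, for the index `α` and the
normalising sequence `b_n → ∞`: it is a finite measure with `H(C) = ν({‖x‖ ≥ 1, x/‖x‖ ∈ C})`
for the exponent measure `ν` of `X`, and `n P((R / b_n, ω) ∈ ·)` tends vaguely to `ν_α × H`. -/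
def HasAngularMeasure {Ω : Type*} [MeasurableSpace Ω] {d : ℕ} (P : Measure Ω)
    (N : Seminorm ℝ (Fin d → ℝ)) (X : Ω → Fin d → ℝ≥0) (α : ℝ) (b : ℕ → ℝ≥0)
    (H : Measure (PosSphere N)) : Prop :=
  Tendsto b atTop atTop ∧ IsFiniteMeasure H ∧
  (∃ ν : Measure (Punctured d), HasExponentMeasure P X b ν ∧
    ∀ C : Set (PosSphere N), MeasurableSet C → H C = ν (outerCone N C)) ∧
  VagueTendsto (scaledPolarLaw P N X b) ((powerMeasure α).prod H)

/-- `X ∈ RV_+^d(α)`: for every norm there are a normalising sequence and a non-zero angular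
measure. (With a zero limit allowed, every random vector would qualify.) -/
def IsRegularlyVarying {Ω : Type*} [MeasurableSpace Ω] {d : ℕ} (P : Measure Ω)
    (X : Ω → Fin d → ℝ≥0) (α : ℝ) : Prop :=
  0 < α ∧ ∀ N : Seminorm ℝ (Fin d → ℝ), IsNorm N →
    ∃ (b : ℕ → ℝ≥0) (H : Measure (PosSphere N)), H ≠ 0 ∧ HasAngularMeasure P N X α b H

/-- Standardised components: `n P(n^(-1/α) Z_i > z) → z^(-α)` for all `z > 0` and all `i`. -/
def IsStandardised {Ω : Type*} [MeasurableSpace Ω] {d : ℕ} (P : Measure Ω)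
    (Z : Ω → Fin d → ℝ≥0) (α : ℝ) : Prop :=
  ∀ i : Fin d, ∀ z : ℝ, 0 < z →
    Tendsto (fun n : ℕ => (n : ℝ) * P.real {ω | z < (n : ℝ) ^ (-(1 / α)) * (Z ω i : ℝ)})
      atTop (𝓝 (z ^ (-α)))

/-- The discrete measure `∑_j ‖a_j‖^α δ_{a_j / ‖a_j‖}` on the positive unit sphere, with `a_j` the
`j`-th column of `A`. A zero column has weight `0 ^ α = 0`. -/
def columnAngularMeasure {d : ℕ} (N : Seminorm ℝ (Fin d → ℝ))
    (A : Matrix (Fin d) (Fin d) ℝ≥0) (α : ℝ) : Measure (PosSphere N) :=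
  (∑ j : Fin d, ((posNorm N (fun i => A i j) ^ α : ℝ≥0) : ℝ≥0∞) •
    Measure.dirac ((posNorm N (fun i => A i j))⁻¹ • (fun i => A i j))).comap Subtype.val

end MRV

end

/-!
A heavy-tailed vector with independent coordinates has at most one large coordinate. Far from the
origin, the law of `Z / b_n`, multiplied by `n`, therefore tends to the measure on the coordinate
axes that carries one copy of `α x ^ (-α - 1) dx` per axis. Boxes that leave out a neighbourhood of
the origin form a convergence-determining class, and on them the convergence is read off from the
product formula.

Convergence away from the origin is preserved by the continuous map `A *ᵥ ·`, which fixes the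
origin and sends the axis `j` to the ray spanned by the column `a_j`. Substituting `r = x ‖a_j‖` on
this ray turns `α x ^ (-α - 1) dx` into `‖a_j‖ ^ α • ν_α`, so in polar coordinates the limit is the
product of `ν_α` and `∑ j, ‖a_j‖ ^ α • δ_{a_j / ‖a_j‖}`. Compact sets of both punctured spaces stay
away from the origin, so that both vague convergences follow from this single limit. Uniqueness of
the angular measure is uniqueness of the vague limit `ν_X`.
-/

namespace MRV

section AwayFrom

open scoped BoundedContinuousFunction

lemma integral_comap_subtype_coe {T : Type*} [MeasurableSpace T] {μ : Measure T} {U : Set T}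
    (hU : MeasurableSet U) {f : T → ℝ} (hf : ∀ x ∉ U, f x = 0) :
    ∫ x : U, f x ∂μ.comap (↑) = ∫ x, f x ∂μ := by
  rw [integral_subtype_comap hU, setIntegral_eq_integral_of_forall_compl_eq_zero hf]

variable {T ι : Type*} [TopologicalSpace T] [MeasurableSpace T] {l : Filter ι} {t₀ : T}

theorem tendsto_finiteMeasure_of_isPiSystem [SecondCountableTopology T] [OpensMeasurableSpace T]
    [l.IsCountablyGenerated] {S : Set (Set T)} (hS : IsPiSystem S)
    (hmeas : ∀ s ∈ S, MeasurableSet s)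
    (hnhds : ∀ u : Set T, IsOpen u → ∀ x ∈ u, ∃ s ∈ S, s ∈ 𝓝 x ∧ s ⊆ u)
    {μ : ι → FiniteMeasure T} {ν : FiniteMeasure T}
    (hmass : Tendsto (fun i => (μ i).mass) l (𝓝 ν.mass))
    (hlim : ∀ s ∈ S, Tendsto (fun i => μ i s) l (𝓝 (ν s))) : Tendsto μ l (𝓝 ν) := by
  by_cases hν : ν = 0
  · subst hν
    exact FiniteMeasure.tendsto_zero_of_tendsto_zero_mass (by simpa using hmass)
  have hmass_ne : ν.mass ≠ 0 := ν.mass_nonzero_iff.2 hν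
  have : Nonempty T := by
    by_contra h
    rw [not_nonempty_iff] at h
    exact hν (Subtype.ext (Measure.eq_zero_of_isEmpty _))
  refine (FiniteMeasure.tendsto_normalize_iff_tendsto hν).1 ⟨?_, hmass⟩
  refine hS.tendsto_probabilityMeasure_of_tendsto_of_mem hmeas hnhds fun s hs => ?_
  rw [ν.normalize_eq_of_nonzero hν]
  refine ((hmass.inv₀ hmass_ne).mul (hlim s hs)).congr' ?_
  filter_upwards [hmass.eventually_ne hmass_ne] with i hi
  rw [(μ i).normalize_eq_of_nonzero ((μ i).mass_nonzero_iff.1 hi)]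

/-- Convergence of measures away from the point `t₀`, also called `M_O`-convergence: the integrals
of the bounded continuous functions that vanish near `t₀` converge. The measures may have infinite
mass near `t₀`. -/
def TendstoAwayFrom (t₀ : T) (μ : ι → Measure T) (l : Filter ι) (ν : Measure T) : Prop :=
  ∀ f : T →ᵇ ℝ, f =ᶠ[𝓝 t₀] 0 → Tendsto (fun i => ∫ t, f t ∂μ i) l (𝓝 (∫ t, f t ∂ν))

theorem TendstoAwayFrom.map {T' : Type*} [TopologicalSpace T'] [MeasurableSpace T']
    [OpensMeasurableSpace T] [BorelSpace T'] {μ : ι → Measure T} {ν : Measure T}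
    (h : TendstoAwayFrom t₀ μ l ν) {φ : T → T'} (hφ : Continuous φ) :
    TendstoAwayFrom (φ t₀) (fun i => (μ i).map φ) l (ν.map φ) := by
  intro f hf
  have hint (m : Measure T) : ∫ t, f t ∂m.map φ = ∫ t, f.compContinuous ⟨φ, hφ⟩ t ∂m :=
    integral_map hφ.aemeasurable f.continuous.aestronglyMeasurable
  simp only [hint]
  exact h _ (hφ.continuousAt.eventually hf)

theorem tendsto_integral_of_isPiSystem_of_isOpen [SecondCountableTopology T]
    [OpensMeasurableSpace T] [l.IsCountablyGenerated] {S : Set (Set T)} (hS : IsPiSystem S)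
    (hmeas : ∀ s ∈ S, MeasurableSet s) {U : Set T} (hU : IsOpen U)
    (hnhds : ∀ u ⊆ U, IsOpen u → ∀ x ∈ u, ∃ s ∈ S, s ∈ 𝓝 x ∧ s ⊆ u)
    {μ : ι → Measure T} {ν : Measure T} (hμ : ∀ i, μ i U ≠ ∞) (hν : ν U ≠ ∞)
    (hmass : Tendsto (fun i => (μ i).real U) l (𝓝 (ν.real U)))
    (hlim : ∀ s ∈ S, s ⊆ U → Tendsto (fun i => (μ i).real s) l (𝓝 (ν.real s)))
    {f : T →ᵇ ℝ} (hf : ∀ x ∉ U, f x = 0) :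
    Tendsto (fun i => ∫ x, f x ∂μ i) l (𝓝 (∫ x, f x ∂ν)) := by
  have hfinite (m : Measure T) (hm : m U ≠ ∞) : IsFiniteMeasure (m.comap ((↑) : U → T)) :=
    ⟨by simpa [comap_subtype_coe_apply hU.measurableSet] using hm.lt_top⟩
  simp only [← fun m => integral_comap_subtype_coe (μ := m) hU.measurableSet hf]
  refine (FiniteMeasure.tendsto_iff_forall_integral_tendsto (F := l)
    (μs := fun i => ⟨(μ i).comap Subtype.val, hfinite (μ i) (hμ i)⟩)
    (μ := ⟨ν.comap Subtype.val, hfinite ν hν⟩)).1 ?_ (f.compContinuous ⟨_, continuous_subtype_val⟩)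
  refine tendsto_finiteMeasure_of_isPiSystem (T := U)
    (S := {s' | ∃ s ∈ S, s ⊆ U ∧ ((↑) : U → T) ⁻¹' s = s'}) ?_ ?_ ?_ ?_ ?_
  · rintro _ ⟨s, hs, hsU, rfl⟩ _ ⟨t, ht, -, rfl⟩ hst
    exact ⟨s ∩ t, hS s hs t ht ⟨_, hst.some_mem⟩, Set.inter_subset_left.trans hsU, rfl⟩
  · rintro _ ⟨s, hs, -, rfl⟩
    exact (hmeas s hs).preimage measurable_subtype_coe
  · intro u hu x hx
    obtain ⟨s, hs, hsx, hsu⟩ := hnhds _ (Subtype.coe_image_subset U u)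
      (hU.isOpenMap_subtype_val u hu) x ⟨x, hx, rfl⟩
    exact ⟨_, ⟨s, hs, hsu.trans (Subtype.coe_image_subset U u), rfl⟩,
      continuous_subtype_val.continuousAt hsx,
      (Set.preimage_mono hsu).trans (Set.preimage_image_eq u Subtype.val_injective).le⟩
  · rw [← NNReal.tendsto_coe]
    simpa [measureReal_def, FiniteMeasure.mass, FiniteMeasure.coeFn_def,
      ENNReal.coe_toNNReal_eq_toReal, comap_subtype_coe_apply hU.measurableSet] using hmass
  · rintro _ ⟨s, hs, hsU, rfl⟩
    rw [← NNReal.tendsto_coe]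
    simpa [measureReal_def, FiniteMeasure.coeFn_def, ENNReal.coe_toNNReal_eq_toReal,
      comap_subtype_coe_apply hU.measurableSet, Set.inter_eq_right.2 hsU] using hlim s hs hsU

theorem tendstoAwayFrom_of_isPiSystem [SecondCountableTopology T] [OpensMeasurableSpace T]
    [l.IsCountablyGenerated] {S : Set (Set T)} (hS : IsPiSystem S)
    (hmeas : ∀ s ∈ S, MeasurableSet s)
    (hnhds : ∀ u : Set T, IsOpen u → t₀ ∉ u → ∀ x ∈ u, ∃ s ∈ S, s ∈ 𝓝 x ∧ s ⊆ u)
    (hcover : ∀ V ∈ 𝓝 t₀, ∃ t : Finset (Set T),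
      (∀ s ∈ t, s ∈ S ∧ IsOpen s ∧ t₀ ∉ s) ∧ (⋃ s ∈ t, s)ᶜ ⊆ V)
    {μ : ι → Measure T} {ν : Measure T} (hμ : ∀ s ∈ S, ∀ i, μ i s ≠ ∞) (hν : ∀ s ∈ S, ν s ≠ ∞)
    (hlim : ∀ s ∈ S, Tendsto (fun i => (μ i).real s) l (𝓝 (ν.real s))) :
    TendstoAwayFrom t₀ μ l ν := by
  intro f hf
  obtain ⟨t, ht, htf⟩ := hcover _ hf
  have ht₀ : t₀ ∉ ⋃ s ∈ t, s := by simpa using fun s hs => (ht s hs).2.2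
  refine tendsto_integral_of_isPiSystem_of_isOpen hS hmeas
    (isOpen_biUnion fun s hs => (ht s hs).2.1)
    (fun u hut hu => hnhds u hu fun h => ht₀ (hut h)) (fun i => ?_) ?_
    (hS.tendsto_measureReal_biUnion (fun s hs => (ht s hs).1) hmeas hlim hν hμ)
    (fun s hs _ => hlim s hs) (fun x hx => htf hx)
  · exact (measure_biUnion_lt_top t.finite_toSet fun s hs => (hμ s (ht s hs).1 i).lt_top).ne
  · exact (measure_biUnion_lt_top t.finite_toSet fun s hs => (hν s (ht s hs).1).lt_top).ne

end AwayFrom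

section ProductMeasures

/-- The half-open intervals of `ℝ≥0` that stay away from `0`. The end points are taken in `ℝ≥0∞`,
so that unbounded intervals are included. -/
def tailIntervals : Set (Set ℝ≥0) := {s | ∃ a b : ℝ≥0∞, 0 < a ∧ (↑) ⁻¹' Set.Ioc a b = s}

/-- The closed intervals of `ℝ≥0` that are neighbourhoods of `0`, including `ℝ≥0` itself. -/
def headIntervals : Set (Set ℝ≥0) := {s | ∃ b : ℝ≥0∞, 0 < b ∧ (↑) ⁻¹' Set.Iic b = s}

lemma zero_notMem_of_mem_tailIntervals {s : Set ℝ≥0} (hs : s ∈ tailIntervals) : 0 ∉ s := by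
  obtain ⟨a, b, -, rfl⟩ := hs
  simp

lemma zero_mem_of_mem_headIntervals {s : Set ℝ≥0} (hs : s ∈ headIntervals) : 0 ∈ s := by
  obtain ⟨b, -, rfl⟩ := hs
  simp

lemma measurableSet_of_mem_tailIntervals {s : Set ℝ≥0} (hs : s ∈ tailIntervals) :
    MeasurableSet s := by
  obtain ⟨a, b, -, rfl⟩ := hs
  exact measurable_coe_nnreal_ennreal measurableSet_Ioc

lemma measurableSet_of_mem_headIntervals {s : Set ℝ≥0} (hs : s ∈ headIntervals) :
    MeasurableSet s := by
  obtain ⟨b, -, rfl⟩ := hs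
  exact measurable_coe_nnreal_ennreal measurableSet_Iic

lemma measurableSet_of_mem_union {s : Set ℝ≥0} (hs : s ∈ headIntervals ∪ tailIntervals) :
    MeasurableSet s :=
  hs.elim measurableSet_of_mem_headIntervals measurableSet_of_mem_tailIntervals

lemma compl_mem_tailIntervals {s : Set ℝ≥0} (hs : s ∈ headIntervals) : sᶜ ∈ tailIntervals := by
  obtain ⟨b, hb, rfl⟩ := hs
  exact ⟨b, ⊤, hb, by simp [← Set.preimage_compl]⟩

lemma inter_mem_tailIntervals {s t : Set ℝ≥0} (hs : s ∈ tailIntervals)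
    (ht : t ∈ headIntervals ∪ tailIntervals) : s ∩ t ∈ tailIntervals := by
  obtain ⟨a, b, ha, rfl⟩ := hs
  obtain ⟨b', -, rfl⟩ | ⟨a', b', -, rfl⟩ := ht
  · exact ⟨a, b ⊓ b', ha, by
      rw [← Set.preimage_inter, ← Set.Ioi_inter_Iic, ← Set.Ioi_inter_Iic, Set.inter_assoc,
        Set.Iic_inter_Iic]⟩
  · exact ⟨a ⊔ a', b ⊓ b', lt_sup_of_lt_left ha, by rw [← Set.preimage_inter, Set.Ioc_inter_Ioc]⟩

lemma inter_mem_headIntervals_union_tailIntervals {s t : Set ℝ≥0}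
    (hs : s ∈ headIntervals ∪ tailIntervals) (ht : t ∈ headIntervals ∪ tailIntervals) :
    s ∩ t ∈ headIntervals ∪ tailIntervals := by
  obtain hs | hs := hs
  · obtain ht' | ht' := ht
    · obtain ⟨b, hb, rfl⟩ := hs
      obtain ⟨b', hb', rfl⟩ := ht'
      exact .inl ⟨b ⊓ b', lt_inf_iff.2 ⟨hb, hb'⟩, by rw [← Set.preimage_inter, Set.Iic_inter_Iic]⟩
    · exact .inr (Set.inter_comm t s ▸ inter_mem_tailIntervals ht' (.inl hs))
  · exact .inr (inter_mem_tailIntervals hs ht)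

lemma exists_mem_tailIntervals_subset {x : ℝ≥0} (hx : 0 < x) {V : Set ℝ≥0} (hV : V ∈ 𝓝 x) :
    ∃ s ∈ tailIntervals, s ∈ 𝓝 x ∧ s ⊆ V := by
  obtain ⟨a, b, ⟨hax, hxb⟩, hab⟩ :=
    (mem_nhds_iff_exists_Ioo_subset' ⟨0, hx⟩ ⟨x + 1, lt_add_one x⟩).1 hV
  obtain ⟨a', haa', hax'⟩ := exists_between hax
  obtain ⟨b', hxb', hbb'⟩ := exists_between hxb
  have hIoc : ((↑) : ℝ≥0 → ℝ≥0∞) ⁻¹' Set.Ioc ↑a' ↑b' = Set.Ioc a' b' := by ext; simp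
  exact ⟨_, ⟨a', b', by simpa using haa'.bot_lt, hIoc⟩, Ioc_mem_nhds hax' hxb',
    fun y hy => hab ⟨haa'.trans hy.1, hy.2.trans_lt hbb'⟩⟩

lemma exists_mem_headIntervals_subset {V : Set ℝ≥0} (hV : V ∈ 𝓝 0) :
    ∃ s ∈ headIntervals, s ∈ 𝓝 0 ∧ s ⊆ V := by
  obtain ⟨b, hb, hbV⟩ := nhds_bot_basis.mem_iff.1 hV
  obtain ⟨b', hb', hbb'⟩ := exists_between hb
  have hIic : ((↑) : ℝ≥0 → ℝ≥0∞) ⁻¹' Set.Iic ↑b' = Set.Iic b' := by ext; simp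
  exact ⟨_, ⟨b', by simpa using hb', hIic⟩, Iic_mem_nhds hb',
    fun y hy => hbV (lt_of_le_of_lt hy hbb')⟩

section Marginals

variable {m : ℕ → Measure ℝ≥0} {ν : Measure ℝ≥0}

lemma measure_ne_top_of_mem_tailIntervals (hν : ∀ z, 0 < z → ν (Set.Ioi z) ≠ ∞) {s : Set ℝ≥0}
    (hs : s ∈ tailIntervals) : ν s ≠ ∞ := by
  obtain ⟨a, b, ha, rfl⟩ := hs
  obtain ⟨z, hz, hza⟩ := ENNReal.lt_iff_exists_nnreal_btwn.1 ha
  refine ne_top_of_le_ne_top (hν z (by simpa using hz)) (measure_mono fun x hx => ?_)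
  exact ENNReal.coe_lt_coe.1 (hza.trans hx.1)

lemma tendsto_mul_measureReal_of_mem_tailIntervals [∀ n, IsFiniteMeasure (m n)]
    (hν : ∀ z, 0 < z → ν (Set.Ioi z) ≠ ∞)
    (hlim : ∀ z, 0 < z →
      Tendsto (fun n : ℕ => n * (m n).real (Set.Ioi z)) atTop (𝓝 (ν.real (Set.Ioi z))))
    {s : Set ℝ≥0} (hs : s ∈ tailIntervals) :
    Tendsto (fun n : ℕ => n * (m n).real s) atTop (𝓝 (ν.real s)) := by
  obtain ⟨a, b, ha, rfl⟩ := hs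
  obtain hab | hab := le_or_gt b a
  · simp [Set.Ioc_eq_empty_of_le hab]
  lift a to ℝ≥0 using hab.ne_top
  rw [ENNReal.coe_pos] at ha
  induction b with
  | top =>
    have hIoi : ((↑) : ℝ≥0 → ℝ≥0∞) ⁻¹' Set.Ioc ↑a ⊤ = Set.Ioi a := by ext; simp
    simpa only [hIoi] using hlim a ha
  | coe b =>
    rw [ENNReal.coe_lt_coe] at hab
    have hIoc : ((↑) : ℝ≥0 → ℝ≥0∞) ⁻¹' Set.Ioc ↑a ↑b = Set.Ioi a \ Set.Ioi b := by
      ext; simp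
    have hsub : Set.Ioi b ⊆ Set.Ioi a := Set.Ioi_subset_Ioi hab.le
    simp only [hIoc, fun n => measureReal_sdiff (μ := m n) hsub measurableSet_Ioi, mul_sub]
    rw [measureReal_sdiff hsub measurableSet_Ioi (hν a ha)]
    exact (hlim a ha).sub (hlim b (ha.trans hab))

lemma tendsto_measureReal_indicator [∀ n, IsProbabilityMeasure (m n)]
    (hlim : ∀ s ∈ tailIntervals, Tendsto (fun n : ℕ => n * (m n).real s) atTop (𝓝 (ν.real s)))
    {s : Set ℝ≥0} (hs : s ∈ headIntervals ∪ tailIntervals) :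
    Tendsto (fun n => (m n).real s) atTop (𝓝 (s.indicator 1 0)) := by
  have htail {s : Set ℝ≥0} (hs : s ∈ tailIntervals) :
      Tendsto (fun n => (m n).real s) atTop (𝓝 0) := by
    have h := (hlim s hs).mul (tendsto_inv_atTop_zero.comp tendsto_natCast_atTop_atTop)
    rw [mul_zero] at h
    refine h.congr' ?_
    filter_upwards [eventually_ne_atTop 0] with n hn
    simp only [Function.comp_apply]
    field_simp
  obtain hs | hs := hs
  · have h := (htail (compl_mem_tailIntervals hs)).const_sub 1
    have hs_meas := measurableSet_of_mem_headIntervals hs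
    simp only [fun n => probReal_compl_eq_one_sub (μ := m n) hs_meas, sub_sub_cancel,
      sub_zero] at h
    simpa [zero_mem_of_mem_headIntervals hs] using h
  · simpa [zero_notMem_of_mem_tailIntervals hs] using htail hs

end Marginals

variable {ι : Type*}

/-- The boxes with sides in `headIntervals` and `tailIntervals` that stay away from the origin. -/
def tailBoxes (ι : Type*) : Set (Set (ι → ℝ≥0)) :=
  {s | ∃ I : ι → Set ℝ≥0, (∀ i, I i ∈ headIntervals ∪ tailIntervals) ∧
    (∃ j, I j ∈ tailIntervals) ∧ Set.univ.pi I = s}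

lemma isPiSystem_tailBoxes : IsPiSystem (tailBoxes ι) := by
  rintro _ ⟨I, hI, ⟨j, hj⟩, rfl⟩ _ ⟨J, hJ, -, rfl⟩ -
  exact ⟨fun i => I i ∩ J i, fun i => inter_mem_headIntervals_union_tailIntervals (hI i) (hJ i),
    ⟨j, inter_mem_tailIntervals hj (hJ j)⟩, Set.pi_inter_distrib⟩

lemma measurableSet_of_mem_tailBoxes [Countable ι] {s : Set (ι → ℝ≥0)} (hs : s ∈ tailBoxes ι) :
    MeasurableSet s := by
  obtain ⟨I, hI, -, rfl⟩ := hs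
  exact MeasurableSet.univ_pi fun i => measurableSet_of_mem_union (hI i)

lemma exists_mem_tailBoxes_subset [Finite ι] {u : Set (ι → ℝ≥0)} (hu : IsOpen u) (h0 : 0 ∉ u)
    {x : ι → ℝ≥0} (hx : x ∈ u) : ∃ s ∈ tailBoxes ι, s ∈ 𝓝 x ∧ s ⊆ u := by
  obtain ⟨V, hV, hVu⟩ := isOpen_pi_iff'.1 hu x hx
  have hside (i) : ∃ s ∈ headIntervals ∪ tailIntervals,
      s ∈ 𝓝 (x i) ∧ s ⊆ V i ∧ (0 < x i → s ∈ tailIntervals) := by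
    have hVi : V i ∈ 𝓝 (x i) := (hV i).1.mem_nhds (hV i).2
    obtain hxi | hxi := eq_zero_or_pos (x i)
    · obtain ⟨s, hs, hsx, hsV⟩ := exists_mem_headIntervals_subset (hxi ▸ hVi)
      exact ⟨s, .inl hs, hxi ▸ hsx, hsV, fun h => (h.ne' hxi).elim⟩
    · obtain ⟨s, hs, hsx, hsV⟩ := exists_mem_tailIntervals_subset hxi hVi
      exact ⟨s, .inr hs, hsx, hsV, fun _ => hs⟩
  choose I hI hIx hIV hItail using hside
  obtain ⟨j, hj⟩ := Function.ne_iff.1 (show x ≠ 0 from fun h => h0 (h ▸ hx))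
  exact ⟨_, ⟨I, hI, ⟨j, hItail j (pos_iff_ne_zero.2 hj)⟩, rfl⟩,
    set_pi_mem_nhds Set.finite_univ fun i _ => hIx i,
    (Set.pi_mono fun i _ => hIV i).trans hVu⟩

lemma setOf_lt_apply_mem_tailBoxes (i : ι) {ε : ℝ≥0} (hε : 0 < ε) :
    {z : ι → ℝ≥0 | ε < z i} ∈ tailBoxes ι := by
  classical
  have hIoi : Set.Ioi ε ∈ tailIntervals := ⟨ε, ⊤, by simpa using hε, by ext; simp⟩
  have huniv : Set.univ ∈ headIntervals := ⟨⊤, by simp, by simp⟩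
  refine ⟨Function.update (fun _ => Set.univ) i (Set.Ioi ε), fun k => ?_, ⟨i, by simpa⟩, ?_⟩
  · obtain rfl | hk := eq_or_ne k i
    · simpa using Or.inr hIoi
    · simpa [hk] using Or.inl huniv
  · exact Set.univ_pi_update_univ (α := fun _ => ℝ≥0) i (Set.Ioi ε)

lemma exists_tailBoxes_cover [Finite ι] {V : Set (ι → ℝ≥0)} (hV : V ∈ 𝓝 0) :
    ∃ t : Finset (Set (ι → ℝ≥0)),
      (∀ s ∈ t, s ∈ tailBoxes ι ∧ IsOpen s ∧ 0 ∉ s) ∧ (⋃ s ∈ t, s)ᶜ ⊆ V := by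
  have := Fintype.ofFinite ι
  obtain ⟨ε, hε, hεV⟩ := Metric.nhds_basis_closedBall.mem_iff.1 hV
  lift ε to ℝ≥0 using hε.le
  refine ⟨(Set.finite_range fun i => {z : ι → ℝ≥0 | ε < z i}).toFinset, ?_, fun z hz => hεV ?_⟩
  · simp only [Set.Finite.mem_toFinset, Set.forall_mem_range]
    exact fun i => ⟨setOf_lt_apply_mem_tailBoxes i hε,
      isOpen_lt continuous_const (continuous_apply i), by simp⟩
  · refine (dist_pi_le_iff ε.2).2 fun i => ?_
    have hzi : z i ≤ ε := not_lt.1 fun h => hz (by simpa using ⟨i, h⟩)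
    simpa [NNReal.dist_eq] using hzi

lemma measurable_single [DecidableEq ι] (i : ι) :
    Measurable (Pi.single (M := fun _ => ℝ≥0) i) :=
  measurable_update 0

lemma preimage_single_univ_pi [DecidableEq ι] (i : ι) (I : ι → Set ℝ≥0) :
    Pi.single i ⁻¹' Set.univ.pi I = {x | x ∈ I i ∧ ∀ k ≠ i, 0 ∈ I k} := by
  ext x
  simpa [Pi.single] using Function.forall_update_iff (0 : ι → ℝ≥0) fun k y => y ∈ I k

variable [Fintype ι]

/-- The measure on the axes of the orthant whose restriction to the `i`-th axis is `ν i`. -/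
noncomputable def axisMeasure [DecidableEq ι] (ν : ι → Measure ℝ≥0) : Measure (ι → ℝ≥0) :=
  ∑ i, (ν i).map (Pi.single i)

lemma axisMeasure_univ_pi [DecidableEq ι] (ν : ι → Measure ℝ≥0) {I : ι → Set ℝ≥0}
    (hI : ∀ i, MeasurableSet (I i)) {j : ι} (hj : 0 ∉ I j) :
    axisMeasure ν (Set.univ.pi I) = ν j {x | x ∈ I j ∧ ∀ k ≠ j, 0 ∈ I k} := by
  have hmap (i) : (ν i).map (Pi.single i) (Set.univ.pi I) =
      ν i {x | x ∈ I i ∧ ∀ k ≠ i, 0 ∈ I k} := by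
    rw [Measure.map_apply (measurable_single i) (.univ_pi hI), preimage_single_univ_pi]
  rw [axisMeasure, Measure.finsetSum_apply, ← hmap]
  refine Finset.sum_eq_single_of_mem j (Finset.mem_univ j) fun i _ hij => ?_
  exact (hmap i).trans (measure_mono_null (fun x hx => hj (hx.2 j hij.symm)) measure_empty)

lemma axisMeasure_real_univ_pi [DecidableEq ι] (ν : ι → Measure ℝ≥0) {I : ι → Set ℝ≥0}
    (hI : ∀ i, MeasurableSet (I i)) {j : ι} (hj : 0 ∉ I j) :
    (axisMeasure ν).real (Set.univ.pi I) =
      (ν j).real (I j) * ∏ k ∈ Finset.univ.erase j, (I k).indicator 1 0 := by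
  rw [measureReal_def, axisMeasure_univ_pi ν hI hj, ← measureReal_def]
  by_cases h : ∀ k ≠ j, 0 ∈ I k
  · rw [Finset.prod_eq_one fun k hk => by simp [h k (Finset.ne_of_mem_erase hk)], mul_one]
    congr! 1
    exact Set.ext fun x => and_iff_left h
  · have hempty : {x | x ∈ I j ∧ ∀ k ≠ j, 0 ∈ I k} = ∅ :=
      Set.eq_empty_of_forall_notMem fun x hx => h hx.2
    push Not at h
    obtain ⟨k, hkj, hk⟩ := h
    rw [hempty, Finset.prod_eq_zero (i := k) (by simpa using hkj) (by simp [hk]),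
      measureReal_empty, mul_zero]

theorem tendstoAwayFrom_pi [DecidableEq ι] {m : ℕ → ι → Measure ℝ≥0}
    [∀ n i, IsProbabilityMeasure (m n i)] {ν : ι → Measure ℝ≥0}
    (hν : ∀ i z, 0 < z → ν i (Set.Ioi z) ≠ ∞)
    (hlim : ∀ i z, 0 < z →
      Tendsto (fun n : ℕ => n * (m n i).real (Set.Ioi z)) atTop (𝓝 ((ν i).real (Set.Ioi z)))) :
    TendstoAwayFrom 0 (fun n : ℕ => (n : ℝ≥0∞) • Measure.pi (m n)) atTop (axisMeasure ν) := by
  have htail (i) {s} (hs : s ∈ tailIntervals) :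
      Tendsto (fun n : ℕ => n * (m n i).real s) atTop (𝓝 ((ν i).real s)) :=
    tendsto_mul_measureReal_of_mem_tailIntervals (hν i) (hlim i) hs
  refine tendstoAwayFrom_of_isPiSystem isPiSystem_tailBoxes
    (fun s => measurableSet_of_mem_tailBoxes) (fun u hu h0 x => exists_mem_tailBoxes_subset hu h0)
    (fun V => exists_tailBoxes_cover) (fun s _ n => ?_) (fun s hs => ?_) (fun s hs => ?_)
  · simp [ENNReal.mul_eq_top]
  · obtain ⟨I, hI, ⟨j, hj⟩, rfl⟩ := hs
    rw [axisMeasure_univ_pi ν (fun i => measurableSet_of_mem_union (hI i))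
      (zero_notMem_of_mem_tailIntervals hj)]
    exact ne_top_of_le_ne_top (measure_ne_top_of_mem_tailIntervals (hν j) hj)
      (measure_mono fun x hx => hx.1)
  · obtain ⟨I, hI, ⟨j, hj⟩, rfl⟩ := hs
    rw [axisMeasure_real_univ_pi ν (fun i => measurableSet_of_mem_union (hI i))
      (zero_notMem_of_mem_tailIntervals hj)]
    refine ((htail j hj).mul (tendsto_finsetProd _ fun k _ =>
      tendsto_measureReal_indicator (fun s => htail k) (hI k))).congr fun n => ?_
    rw [mul_assoc, Finset.mul_prod_erase _ (fun k => (m n k).real (I k)) (Finset.mem_univ j)]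
    simp [measureReal_def, Measure.pi_pi, ENNReal.toReal_prod]

end ProductMeasures

section Compactification

variable {T E E' : Type*} {e : E → E'} {ψ : T → E'} {t₀ : T} {f : E → ℝ}

lemma integral_comap_eq_integral_extend_zero [MeasurableSpace E] [MeasurableSpace E']
    (he : MeasurableEmbedding e) (μ : Measure E') (f : E → ℝ) :
    ∫ x, f x ∂μ.comap e = ∫ y, Function.extend e f 0 y ∂μ := by
  have hf : f = fun x => Function.extend e f 0 (e x) := by simp [he.injective.extend_apply]
  conv_lhs => rw [hf, ← he.integral_map, he.map_comap]
  exact setIntegral_eq_integral_of_forall_compl_eq_zero fun y hy =>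
    Function.extend_apply' _ _ _ hy

variable [TopologicalSpace E]

lemma extend_zero_eq_zero_of_notMem_image_tsupport (he : Function.Injective e) {y : E'}
    (hy : y ∉ e '' tsupport f) : Function.extend e f 0 y = 0 := by
  by_cases h : ∃ x, e x = y
  · obtain ⟨x, rfl⟩ := h
    rw [he.extend_apply]
    exact image_eq_zero_of_notMem_tsupport fun hx => hy ⟨x, hx, rfl⟩
  · exact Function.extend_apply' _ _ _ h

variable [TopologicalSpace T]

lemma continuous_extend_zero_comp [T1Space T] [TopologicalSpace E'] (he : IsEmbedding e)
    (hf : Continuous f) (hψ : ContinuousOn ψ {t₀}ᶜ) (hrange : ∀ t ≠ t₀, ψ t ∈ Set.range e)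
    (h₀ : ∀ᶠ t in 𝓝 t₀, Function.extend e f 0 (ψ t) = 0) :
    Continuous fun t => Function.extend e f 0 (ψ t) := by
  refine continuous_iff_continuousAt.2 fun t => ?_
  obtain rfl | ht := eq_or_ne t t₀
  · exact continuousAt_const.congr (h₀.mono fun _ h => h.symm)
  refine ContinuousOn.continuousAt (s := {t₀}ᶜ) ?_ (isOpen_compl_singleton.mem_nhds ht)
  choose φ hφ using fun t : ({t₀}ᶜ : Set T) => hrange t t.2
  have hφc : Continuous φ := by
    rw [he.continuous_iff]
    exact (continuousOn_iff_continuous_domRestrict.1 hψ).congr fun t => (hφ t).symm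
  rw [continuousOn_iff_continuous_domRestrict]
  exact (hf.comp hφc).congr fun t => by simp [← hφ, he.injective.extend_apply]

variable [MeasurableSpace T] [MeasurableSpace E] [OpensMeasurableSpace E] [MeasurableSpace E']
  {ν : Measure T}

theorem TendstoAwayFrom.vagueTendsto_comap_map [T1Space T] [TopologicalSpace E']
    {μ : ℕ → Measure T} (h : TendstoAwayFrom t₀ μ atTop ν) (he : IsEmbedding e)
    (he_meas : MeasurableEmbedding e) (hψ_meas : Measurable ψ) (hψ : ContinuousOn ψ {t₀}ᶜ)
    (hrange : ∀ t ≠ t₀, ψ t ∈ Set.range e)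
    (hcompact : ∀ K, IsCompact K → ∀ᶠ t in 𝓝 t₀, ψ t ∉ e '' K) :
    VagueTendsto (fun n => ((μ n).map ψ).comap e) ((ν.map ψ).comap e) := by
  intro f hf hf_supp
  have h₀ : ∀ᶠ t in 𝓝 t₀, Function.extend e f 0 (ψ t) = 0 := (hcompact _ hf_supp).mono fun t =>
    extend_zero_eq_zero_of_notMem_image_tsupport he.injective
  obtain ⟨C, hC⟩ := hf_supp.exists_bound_of_continuous hf
  have hbound (t) : ‖Function.extend e f 0 (ψ t)‖ ≤ max C 0 := by
    obtain ⟨x, hx⟩ | ht := em (ψ t ∈ Set.range e)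
    · rw [← hx, he.injective.extend_apply]
      exact (hC x).trans (le_max_left _ _)
    · rw [Function.extend_apply' _ _ _ ht, Pi.zero_apply, norm_zero]
      exact le_max_right _ _
  have hint (m : Measure T) : ∫ x, f x ∂(m.map ψ).comap e =
      ∫ t, Function.extend e f 0 (ψ t) ∂m := by
    rw [integral_comap_eq_integral_extend_zero he_meas, integral_map hψ_meas.aemeasurable]
    exact (he_meas.measurable_extend hf.measurable measurable_zero).aestronglyMeasurable
  simp only [hint]
  exact h (.ofNormedAddCommGroup _ (continuous_extend_zero_comp he hf hψ hrange h₀) _ hbound) h₀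

lemma isFiniteMeasureOnCompacts_comap_map [T2Space E] (hν : ∀ U ∈ 𝓝 t₀, ν Uᶜ ≠ ∞)
    (he : MeasurableEmbedding e) (hψ : Measurable ψ)
    (hcompact : ∀ K, IsCompact K → ∀ᶠ t in 𝓝 t₀, ψ t ∉ e '' K) :
    IsFiniteMeasureOnCompacts ((ν.map ψ).comap e) := by
  refine ⟨fun K hK => ?_⟩
  rw [he.comap_apply, Measure.map_apply hψ (he.measurableSet_image.2 hK.measurableSet)]
  exact (measure_mono fun t ht => not_not.2 ht).trans_lt (hν _ (hcompact K hK)).lt_top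

end Compactification

section PolarCoordinates

variable {d : ℕ} {N : Seminorm ℝ (Fin d → ℝ)}

lemma continuous_posNorm (N : Seminorm ℝ (Fin d → ℝ)) : Continuous (posNorm N) := by
  have hN : Continuous N := continuousOn_univ.1 (N.convexOn.continuousOn isOpen_univ)
  exact (hN.comp (by fun_prop)).subtype_mk _

lemma coe_posNorm (x : Fin d → ℝ≥0) : (posNorm N x : ℝ) = N fun i => (x i : ℝ) := rfl

lemma posNorm_zero : posNorm N 0 = 0 :=
  NNReal.coe_injective (map_zero N)

lemma posNorm_smul (c : ℝ≥0) (x : Fin d → ℝ≥0) : posNorm N (c • x) = c * posNorm N x := by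
  have h := map_smul_eq_mul N (c : ℝ) fun i => (x i : ℝ)
  rw [Real.norm_of_nonneg c.coe_nonneg] at h
  exact NNReal.coe_injective h

lemma posNorm_eq_zero (hN : IsNorm N) {x : Fin d → ℝ≥0} : posNorm N x = 0 ↔ x = 0 := by
  refine ⟨fun h => funext fun i => ?_, fun h => h ▸ posNorm_zero⟩
  exact NNReal.coe_eq_zero.1 (congrFun (hN _ (by rw [← coe_posNorm, h, NNReal.coe_zero])) i)

/-- The direction `x / ‖x‖`, with the junk value `0` where `‖x‖ = 0`. -/
noncomputable def posDirection (N : Seminorm ℝ (Fin d → ℝ)) (x : Fin d → ℝ≥0) : Fin d → ℝ≥0 :=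
  (posNorm N x)⁻¹ • x

lemma measurable_posDirection : Measurable (posDirection N) :=
  (continuous_posNorm N).measurable.inv.smul measurable_id

lemma posNorm_posDirection {x : Fin d → ℝ≥0} (hx : posNorm N x ≠ 0) :
    posNorm N (posDirection N x) = 1 := by
  rw [posDirection, posNorm_smul, inv_mul_cancel₀ hx]

lemma posDirection_smul {c : ℝ≥0} (hc : c ≠ 0) (x : Fin d → ℝ≥0) :
    posDirection N (c • x) = posDirection N x := by
  rw [posDirection, posNorm_smul, smul_smul, mul_inv, mul_right_comm, inv_mul_cancel₀ hc, one_mul,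
    posDirection]

/-- The embedding of the orthant in its compactification. -/
def toExtended (x : Fin d → ℝ≥0) : Fin d → ℝ≥0∞ := fun i => x i

/-- Polar coordinates on the orthant, with radius in the extended half line. -/
noncomputable def toPolar (N : Seminorm ℝ (Fin d → ℝ)) (x : Fin d → ℝ≥0) :
    ℝ≥0∞ × (Fin d → ℝ≥0) :=
  (posNorm N x, posDirection N x)

lemma continuous_toExtended : Continuous (toExtended (d := d)) := by
  unfold toExtended; fun_prop

lemma measurableEmbedding_toExtended : MeasurableEmbedding (toExtended (d := d)) :=
  continuous_toExtended.measurableEmbedding fun _ _ h =>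
    funext fun i => ENNReal.coe_injective (congrFun h i)

lemma measurable_toPolar : Measurable (toPolar N) :=
  (continuous_posNorm N).measurable.coe_nnreal_ennreal.prodMk measurable_posDirection

lemma continuousOn_toPolar (hN : IsNorm N) : ContinuousOn (toPolar N) {0}ᶜ :=
  (ENNReal.continuous_coe.comp (continuous_posNorm N)).continuousOn.prodMk
    (((continuous_posNorm N).continuousOn.inv₀ fun _ hx => mt (posNorm_eq_zero hN).1 hx).smul
      continuousOn_id)

lemma toExtended_mem_range {x : Fin d → ℝ≥0} (hx : x ≠ 0) :
    toExtended x ∈ Set.range (Subtype.val : Punctured d → _) :=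
  ⟨⟨toExtended x, fun h => hx (funext fun i => ENNReal.coe_eq_zero.1 (congrFun h i))⟩, rfl⟩

lemma toPolar_mem_range {x : Fin d → ℝ≥0} (hx : posNorm N x ≠ 0) :
    toPolar N x ∈ Set.range (Prod.map Subtype.val Subtype.val : PosExt × PosSphere N → _) :=
  ⟨(⟨posNorm N x, by simpa [pos_iff_ne_zero] using hx⟩,
    ⟨posDirection N x, posNorm_posDirection hx⟩), rfl⟩

lemma eventually_toExtended_notMem_image {K : Set (Punctured d)} (hK : IsCompact K) :
    ∀ᶠ x : Fin d → ℝ≥0 in 𝓝 0, toExtended x ∉ Subtype.val '' K := by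
  have hclosed : IsClosed (Subtype.val '' K) := (hK.image continuous_subtype_val).isClosed
  refine (continuous_toExtended.tendsto 0).eventually (hclosed.isOpen_compl.mem_nhds ?_)
  rintro ⟨x, -, hx⟩
  exact x.2 (hx.trans (by ext; simp [toExtended]))

lemma eventually_toPolar_notMem_image {K : Set (PosExt × PosSphere N)} (hK : IsCompact K) :
    ∀ᶠ x in 𝓝 0, toPolar N x ∉ Prod.map Subtype.val Subtype.val '' K := by
  have hclosed : IsClosed ((fun p : PosExt × PosSphere N => (p.1 : ℝ≥0∞)) '' K) :=
    (hK.image (by fun_prop)).isClosed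
  have hnorm : Continuous fun x => (posNorm N x : ℝ≥0∞) :=
    ENNReal.continuous_coe.comp (continuous_posNorm N)
  have hzero : (posNorm N 0 : ℝ≥0∞) ∉ (fun p : PosExt × PosSphere N => (p.1 : ℝ≥0∞)) '' K := by
    rintro ⟨p, -, hp⟩
    exact p.1.2.ne' (hp.trans (by simp [posNorm_zero]))
  filter_upwards [(hnorm.tendsto 0).eventually (hclosed.isOpen_compl.mem_nhds hzero)] with x hx
  rintro ⟨p, hp, hpx⟩
  exact hx ⟨p, hp, congrArg Prod.fst hpx⟩

lemma measurableEmbedding_punctured :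
    MeasurableEmbedding (Subtype.val : Punctured d → Fin d → ℝ≥0∞) :=
  .subtype_coe (measurableSet_singleton (0 : Fin d → ℝ≥0∞)).compl

lemma measurableEmbedding_posExt : MeasurableEmbedding (Subtype.val : PosExt → ℝ≥0∞) :=
  .subtype_coe measurableSet_Ioi

lemma measurableEmbedding_posSphere (N : Seminorm ℝ (Fin d → ℝ)) :
    MeasurableEmbedding (Subtype.val : PosSphere N → Fin d → ℝ≥0) :=
  .subtype_coe (isClosed_eq (continuous_posNorm N) continuous_const).measurableSet

lemma measurableEmbedding_posExt_prod_posSphere (N : Seminorm ℝ (Fin d → ℝ)) :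
    MeasurableEmbedding (Prod.map Subtype.val Subtype.val : PosExt × PosSphere N → _) :=
  measurableEmbedding_posExt.prodMap (measurableEmbedding_posSphere N)

/-- A measure on the orthant, restricted to the complement of the origin and read as a measure on
the punctured compactified orthant. -/
noncomputable def cartesianPart (μ : Measure (Fin d → ℝ≥0)) : Measure (Punctured d) :=
  (μ.map toExtended).comap Subtype.val

/-- A measure on the orthant, restricted to the vectors of non-zero norm and read in polar
coordinates. -/
noncomputable def polarPart (N : Seminorm ℝ (Fin d → ℝ)) (μ : Measure (Fin d → ℝ≥0)) :
    Measure (PosExt × PosSphere N) :=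
  (μ.map (toPolar N)).comap (Prod.map Subtype.val Subtype.val)

theorem TendstoAwayFrom.vagueTendsto_cartesianPart {μ : ℕ → Measure (Fin d → ℝ≥0)}
    {ν : Measure (Fin d → ℝ≥0)} (h : TendstoAwayFrom 0 μ atTop ν) :
    VagueTendsto (fun n => cartesianPart (μ n)) (cartesianPart ν) :=
  h.vagueTendsto_comap_map .subtypeVal measurableEmbedding_punctured
    continuous_toExtended.measurable continuous_toExtended.continuousOn
    (fun _ => toExtended_mem_range) fun _ => eventually_toExtended_notMem_image

theorem TendstoAwayFrom.vagueTendsto_polarPart (hN : IsNorm N) {μ : ℕ → Measure (Fin d → ℝ≥0)}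
    {ν : Measure (Fin d → ℝ≥0)} (h : TendstoAwayFrom 0 μ atTop ν) :
    VagueTendsto (fun n => polarPart N (μ n)) (polarPart N ν) :=
  h.vagueTendsto_comap_map (.prodMap .subtypeVal .subtypeVal)
    (measurableEmbedding_posExt_prod_posSphere N) measurable_toPolar (continuousOn_toPolar hN)
    (fun _ hx => toPolar_mem_range (mt (posNorm_eq_zero hN).1 hx))
    fun _ => eventually_toPolar_notMem_image

lemma isFiniteMeasureOnCompacts_cartesianPart {ν : Measure (Fin d → ℝ≥0)}
    (hν : ∀ U ∈ 𝓝 0, ν Uᶜ ≠ ∞) : IsFiniteMeasureOnCompacts (cartesianPart ν) :=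
  isFiniteMeasureOnCompacts_comap_map hν measurableEmbedding_punctured
    continuous_toExtended.measurable fun _ => eventually_toExtended_notMem_image

lemma image_val_outerCone (N : Seminorm ℝ (Fin d → ℝ)) (C : Set (PosSphere N)) :
    Subtype.val '' outerCone N C =
      toExtended '' {x | 1 ≤ posNorm N x ∧ posDirection N x ∈ Subtype.val '' C} := by
  ext x
  constructor
  · rintro ⟨x, ⟨y, hxy, hy, hyC⟩, rfl⟩
    exact ⟨y, ⟨hy, hyC⟩, (funext hxy).symm⟩
  · rintro ⟨y, ⟨hy, hyC⟩, rfl⟩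
    obtain ⟨z, hz⟩ := toExtended_mem_range (x := y) fun h => by simp [h, posNorm_zero] at hy
    exact ⟨z, ⟨y, congrFun hz, hy, hyC⟩, hz⟩

lemma polarPart_prod_apply (μ : Measure (Fin d → ℝ≥0)) {S : Set PosExt} (hS : MeasurableSet S)
    {C : Set (PosSphere N)} (hC : MeasurableSet C) :
    polarPart N μ (S ×ˢ C) = μ (toPolar N ⁻¹' ((Subtype.val '' S) ×ˢ (Subtype.val '' C))) := by
  have hemb := measurableEmbedding_posExt_prod_posSphere N
  rw [polarPart, hemb.comap_apply, Measure.map_apply measurable_toPolar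
    (hemb.measurableSet_image.2 (hS.prod hC)), Set.prodMap_image_prod]

lemma cartesianPart_outerCone (μ : Measure (Fin d → ℝ≥0)) {C : Set (PosSphere N)}
    (hC : MeasurableSet C) :
    cartesianPart μ (outerCone N C) = polarPart N μ ({r | 1 ≤ r.1} ×ˢ C) := by
  have hmeas : MeasurableSet {r : PosExt | 1 ≤ r.1} := measurable_subtype_coe measurableSet_Ici
  have hradius : Subtype.val '' {r : PosExt | 1 ≤ r.1} = Set.Ici 1 := by
    ext r
    simpa using zero_lt_one.trans_le
  rw [cartesianPart, measurableEmbedding_punctured.comap_apply, image_val_outerCone,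
    measurableEmbedding_toExtended.map_apply,
    measurableEmbedding_toExtended.injective.preimage_image,
    polarPart_prod_apply μ hmeas hC, hradius]
  congr! 1
  ext x
  simp [toPolar]

end PolarCoordinates

section TailMeasure

/-- The measure with density `α x ^ (-α - 1)` on `(0, ∞)`, as a measure on `ℝ≥0`. -/
noncomputable def tailMeasure (α : ℝ) : Measure ℝ≥0 :=
  (((volume : Measure ℝ).restrict (Set.Ioi 0)).withDensity
    fun x => ENNReal.ofReal (α * x ^ (-α - 1))).map Real.toNNReal

instance (α : ℝ) : NullSingletonClass (tailMeasure α) := by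
  refine ⟨fun x => ?_⟩
  rw [tailMeasure, Measure.map_apply (by fun_prop) (measurableSet_singleton x)]
  refine withDensity_absolutelyContinuous _ _ ?_
  rw [Measure.restrict_apply (measurable_real_toNNReal (measurableSet_singleton x))]
  refine measure_mono_null (t := {(x : ℝ)}) ?_ Real.volume_singleton
  rintro y ⟨rfl, hy⟩
  exact (Real.coe_toNNReal y hy.le).symm

variable {α : ℝ}

lemma tailMeasure_Ioi (hα : 0 < α) {z : ℝ≥0} (hz : 0 < z) :
    tailMeasure α (Set.Ioi z) = ENNReal.ofReal (z ^ (-α)) := by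
  have hz' : (0 : ℝ) < z := hz
  have hpre : Real.toNNReal ⁻¹' Set.Ioi z = Set.Ioi (z : ℝ) := by
    ext; simp [Real.lt_toNNReal_iff_coe_lt]
  have hint : ∫ x in Set.Ioi (z : ℝ), α * x ^ (-α - 1) = z ^ (-α) := by
    rw [integral_const_mul, integral_Ioi_rpow_of_lt (by linarith) hz', sub_add_cancel]
    field_simp
  rw [tailMeasure, Measure.map_apply (by fun_prop) measurableSet_Ioi, hpre,
    withDensity_apply _ measurableSet_Ioi, Measure.restrict_restrict measurableSet_Ioi,
    Set.inter_eq_left.2 (Set.Ioi_subset_Ioi hz'.le), ← hint,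
    ofReal_integral_eq_lintegral_ofReal
      ((integrableOn_Ioi_rpow_of_lt (by linarith) hz').const_mul α)]
  filter_upwards [ae_restrict_mem measurableSet_Ioi] with x hx
  have hx' : 0 < x := hz'.trans hx
  positivity

lemma tailMeasure_Ioi_ne_top (hα : 0 < α) {z : ℝ≥0} (hz : 0 < z) :
    tailMeasure α (Set.Ioi z) ≠ ∞ := by
  simp [tailMeasure_Ioi hα hz]

lemma tailMeasure_real_Ioi (hα : 0 < α) {z : ℝ≥0} (hz : 0 < z) :
    (tailMeasure α).real (Set.Ioi z) = (z ^ (-α) : ℝ≥0) := by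
  rw [measureReal_def, tailMeasure_Ioi hα hz, ENNReal.toReal_ofReal (by positivity),
    NNReal.coe_rpow]

lemma tailMeasure_compl_ne_top (hα : 0 < α) {U : Set ℝ≥0} (hU : U ∈ 𝓝 0) :
    tailMeasure α Uᶜ ≠ ∞ := by
  obtain ⟨ε, hε, hεU⟩ := nhds_bot_basis_Iic.mem_iff.1 hU
  refine ne_top_of_le_ne_top (tailMeasure_Ioi_ne_top hα hε) (measure_mono ?_)
  simpa using Set.compl_subset_compl.2 hεU

lemma ext_of_measure_Ioi {μ ν : Measure ℝ≥0} (hμ₀ : μ {0} = 0) (hν₀ : ν {0} = 0)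
    (hμ : ∀ z, 0 < z → μ (Set.Ioi z) ≠ ∞) (h : ∀ z, 0 < z → μ (Set.Ioi z) = ν (Set.Ioi z)) :
    μ = ν := by
  have hcover : Set.Ioi (0 : ℝ≥0) = ⋃ n : ℕ, Set.Ioi (1 / ((n : ℝ≥0) + 1)) := by
    ext x
    simp only [Set.mem_Ioi, Set.mem_iUnion]
    exact ⟨exists_nat_one_div_lt, fun ⟨n, hn⟩ => zero_le.trans_lt hn⟩
  have hrestrict : μ.restrict (Set.Ioi 0) = ν.restrict (Set.Ioi 0) := by
    rw [hcover, Measure.restrict_iUnion_congr]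
    intro n
    have hpos : 0 < 1 / ((n : ℝ≥0) + 1) := by positivity
    have : IsFiniteMeasure (μ.restrict (Set.Ioi (1 / ((n : ℝ≥0) + 1)))) :=
      isFiniteMeasure_restrict.2 (hμ _ hpos)
    refine ext_of_generate_finite _ (borel_eq_generateFrom_Ioi ℝ≥0 ▸ BorelSpace.measurable_eq)
      isPiSystem_Ioi ?_ (by simpa only [Measure.restrict_apply_univ] using h _ hpos)
    rintro _ ⟨z, rfl⟩
    rw [Measure.restrict_apply measurableSet_Ioi, Measure.restrict_apply measurableSet_Ioi,
      Set.Ioi_inter_Ioi, h _ (lt_sup_of_lt_right hpos)]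
  have hIoi : Set.Ioi (0 : ℝ≥0) = {0}ᶜ := by ext; simp [pos_iff_ne_zero]
  rwa [hIoi, Measure.restrict_eq_self_of_ae_mem, Measure.restrict_eq_self_of_ae_mem] at hrestrict
  · exact compl_mem_ae_iff.2 hν₀
  · exact compl_mem_ae_iff.2 hμ₀

lemma map_mul_tailMeasure (hα : 0 < α) {c : ℝ≥0} (hc : c ≠ 0) :
    (tailMeasure α).map (· * c) = ((c ^ α : ℝ≥0) : ℝ≥0∞) • tailMeasure α := by
  have hmul : Measurable (· * c : ℝ≥0 → ℝ≥0) := by fun_prop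
  have hIoi (z : ℝ≥0) (hz : 0 < z) : (tailMeasure α).map (· * c) (Set.Ioi z) =
      (((c ^ α : ℝ≥0) : ℝ≥0∞) • tailMeasure α) (Set.Ioi z) := by
    have hpre : (· * c) ⁻¹' Set.Ioi z = Set.Ioi (z / c) := by
      ext x; simp [div_lt_iff₀ (pos_iff_ne_zero.2 hc)]
    rw [Measure.map_apply hmul measurableSet_Ioi, hpre, tailMeasure_Ioi hα (by positivity),
      Measure.smul_apply, tailMeasure_Ioi hα hz, smul_eq_mul, ← ENNReal.ofReal_coe_nnreal,
      ← ENNReal.ofReal_mul (by positivity), NNReal.coe_div,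
      Real.div_rpow z.coe_nonneg c.coe_nonneg, Real.rpow_neg c.coe_nonneg, div_inv_eq_mul,
      mul_comm, NNReal.coe_rpow]
  refine ext_of_measure_Ioi ?_ (by simp) (fun z hz => ?_) hIoi
  · rw [Measure.map_apply hmul (measurableSet_singleton 0)]
    have hpre : (· * c) ⁻¹' {0} = ({0} : Set ℝ≥0) := by ext; simp [hc]
    rw [hpre, measure_singleton]
  · rw [hIoi z hz, Measure.smul_apply]
    exact ENNReal.mul_ne_top ENNReal.coe_ne_top (tailMeasure_Ioi_ne_top hα hz)

lemma powerMeasure_apply (α : ℝ) {S : Set PosExt} (hS : MeasurableSet S) :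
    powerMeasure α S = tailMeasure α ((↑) ⁻¹' (Subtype.val '' S)) := by
  have hS' := measurableEmbedding_posExt.measurableSet_image.2 hS
  rw [powerMeasure, tailMeasure, measurableEmbedding_posExt.comap_apply,
    Measure.map_apply (by fun_prop) hS', Measure.map_apply (by fun_prop) (by measurability)]
  rfl

lemma powerMeasure_setOf_le (hα : 0 < α) {z : ℝ≥0} (hz : 0 < z) :
    powerMeasure α {r | z ≤ r.1} = ENNReal.ofReal (z ^ (-α)) := by
  have hmeas : MeasurableSet {r : PosExt | z ≤ r.1} := measurable_subtype_coe measurableSet_Ici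
  have hpre : (↑) ⁻¹' (Subtype.val '' {r : PosExt | z ≤ r.1}) = Set.Ici z := by
    ext x
    simpa using hz.trans_le
  rw [powerMeasure_apply α hmeas, hpre, ← tailMeasure_Ioi hα hz, measure_congr Ioi_ae_eq_Ici]

lemma sigmaFinite_powerMeasure (hα : 0 < α) : SigmaFinite (powerMeasure α) := by
  refine ⟨⟨⟨fun n : ℕ => {r | ((1 / (n + 1) : ℝ≥0) : ℝ≥0∞) ≤ r.1}, fun _ => trivial,
    fun n => ?_, Set.eq_univ_of_forall fun r => ?_⟩⟩⟩
  · rw [powerMeasure_setOf_le hα (by positivity)]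
    exact ENNReal.ofReal_lt_top
  · obtain ⟨c, hc, hcr⟩ := ENNReal.lt_iff_exists_nnreal_btwn.1 r.2
    obtain ⟨n, hn⟩ := exists_nat_one_div_lt (ENNReal.coe_pos.1 hc)
    exact Set.mem_iUnion.2 ⟨n, (ENNReal.coe_lt_coe.2 hn).le.trans hcr.le⟩

end TailMeasure

section Rays

variable {d : ℕ} {N : Seminorm ℝ (Fin d → ℝ)} {α : ℝ} {ι : Type*} [Fintype ι]

/-- The sum over `j` of the images of `tailMeasure α` on the rays spanned by the vectors `a j`. -/
noncomputable def raysMeasure (a : ι → Fin d → ℝ≥0) (α : ℝ) : Measure (Fin d → ℝ≥0) :=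
  ∑ j, (tailMeasure α).map (· • a j)

/-- The discrete measure `∑_j ‖a_j‖^α δ_{a_j / ‖a_j‖}` on the positive unit sphere, for a finite
family of vectors `a_j`. The directions of vectors of norm zero lie off the sphere. -/
noncomputable def discreteAngularMeasure (N : Seminorm ℝ (Fin d → ℝ)) (a : ι → Fin d → ℝ≥0)
    (α : ℝ) : Measure (PosSphere N) :=
  (∑ j, ((posNorm N (a j) ^ α : ℝ≥0) : ℝ≥0∞) • Measure.dirac (posDirection N (a j))).comap
    Subtype.val

lemma discreteAngularMeasure_apply (N : Seminorm ℝ (Fin d → ℝ)) (a : ι → Fin d → ℝ≥0) (α : ℝ)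
    (C : Set (PosSphere N)) :
    discreteAngularMeasure N a α C = ∑ j, ((posNorm N (a j) ^ α : ℝ≥0) : ℝ≥0∞) *
      Measure.dirac (posDirection N (a j)) (Subtype.val '' C) := by
  rw [discreteAngularMeasure, (measurableEmbedding_posSphere N).comap_apply,
    Measure.finsetSum_apply]
  rfl

instance isFiniteMeasure_discreteAngularMeasure (a : ι → Fin d → ℝ≥0) :
    IsFiniteMeasure (discreteAngularMeasure N a α) := by
  refine ⟨?_⟩
  rw [discreteAngularMeasure_apply]
  exact ENNReal.sum_lt_top.2 fun j _ => ENNReal.mul_lt_top ENNReal.coe_lt_top (measure_lt_top _ _)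

lemma discreteAngularMeasure_ne_zero (hN : IsNorm N) {a : ι → Fin d → ℝ≥0} (ha : a ≠ 0) :
    discreteAngularMeasure N a α ≠ 0 := by
  obtain ⟨j, hj⟩ := Function.ne_iff.1 ha
  have hnorm : posNorm N (a j) ≠ 0 := mt (posNorm_eq_zero hN).1 hj
  refine mt (congrArg fun H : Measure (PosSphere N) => H Set.univ) ?_
  rw [discreteAngularMeasure_apply, Measure.coe_zero, Pi.zero_apply, Finset.sum_eq_zero_iff]
  refine fun h => (mul_ne_zero ?_ ?_) (h j (Finset.mem_univ j))
  · exact ENNReal.coe_ne_zero.2 (NNReal.rpow_pos (pos_iff_ne_zero.2 hnorm)).ne'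
  · rw [Measure.dirac_apply_of_mem]
    · exact one_ne_zero
    · simpa using posNorm_posDirection hnorm

lemma raysMeasure_compl_ne_top (hα : 0 < α) (a : ι → Fin d → ℝ≥0) {U : Set (Fin d → ℝ≥0)}
    (hU : U ∈ 𝓝 0) : raysMeasure a α Uᶜ ≠ ∞ := by
  refine ne_top_of_le_ne_top ?_ (measure_mono (Set.compl_subset_compl.2 interior_subset))
  rw [raysMeasure, Measure.finsetSum_apply]
  refine ENNReal.sum_ne_top.2 fun j _ => ?_
  have hcont : Continuous fun x : ℝ≥0 => x • a j := by fun_prop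
  rw [Measure.map_apply hcont.measurable isOpen_interior.measurableSet.compl]
  refine tailMeasure_compl_ne_top hα (U := (· • a j) ⁻¹' interior U) ?_
  exact hcont.continuousAt.preimage_mem_nhds (by simpa using hU)

lemma polarPart_ray_prod (hα : 0 < α) (a : Fin d → ℝ≥0) {S : Set PosExt} (hS : MeasurableSet S)
    {C : Set (PosSphere N)} (hC : MeasurableSet C) :
    polarPart N ((tailMeasure α).map (· • a)) (S ×ˢ C) = powerMeasure α S *
      (((posNorm N a ^ α : ℝ≥0) : ℝ≥0∞) * Measure.dirac (posDirection N a) (Subtype.val '' C)) := by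
  have hS' := measurableEmbedding_posExt.measurableSet_image.2 hS
  have hC' := (measurableEmbedding_posSphere N).measurableSet_image.2 hC
  have hpre : (· • a) ⁻¹' (toPolar N ⁻¹' ((Subtype.val '' S) ×ˢ (Subtype.val '' C))) =
      {x : ℝ≥0 | ((x * posNorm N a : ℝ≥0) : ℝ≥0∞) ∈ Subtype.val '' S ∧
        posDirection N a ∈ Subtype.val '' C} := by
    ext x
    obtain rfl | hx := eq_or_ne x 0
    · simp [toPolar, posNorm_zero]
    · simp [toPolar, posNorm_smul, posDirection_smul hx]
  rw [polarPart_prod_apply _ hS hC, Measure.map_apply (by fun_prop)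
    (measurable_toPolar (hS'.prod hC')), hpre]
  by_cases hdir : posDirection N a ∈ Subtype.val '' C
  · have hnorm : posNorm N a ≠ 0 := by
      intro h
      obtain ⟨θ, -, hθ⟩ := hdir
      simpa [hθ, posDirection, h, posNorm_zero] using θ.2
    rw [Measure.dirac_apply_of_mem hdir, mul_one, powerMeasure_apply α hS, mul_comm,
      ← smul_eq_mul, ← Measure.smul_apply, ← map_mul_tailMeasure hα hnorm,
      Measure.map_apply (by fun_prop) (measurable_coe_nnreal_ennreal hS')]
    simp only [hdir, and_true]
    rfl
  · simp [hdir, Measure.dirac_apply' _ hC']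

theorem polarPart_raysMeasure (hα : 0 < α) (a : ι → Fin d → ℝ≥0) :
    polarPart N (raysMeasure a α) = (powerMeasure α).prod (discreteAngularMeasure N a α) := by
  have := sigmaFinite_powerMeasure hα
  refine (Measure.prod_eq fun S C hS hC => ?_).symm
  rw [polarPart_prod_apply _ hS hC, raysMeasure, Measure.finsetSum_apply,
    discreteAngularMeasure_apply, Finset.mul_sum]
  exact Finset.sum_congr rfl fun j _ => by
    rw [← polarPart_prod_apply _ hS hC, polarPart_ray_prod hα _ hS hC]

end Rays

section AngularMeasure

variable {Ω : Type*} [MeasurableSpace Ω] {P : Measure Ω} {d : ℕ} {N : Seminorm ℝ (Fin d → ℝ)}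
  {X : Ω → Fin d → ℝ≥0} {α : ℝ} {b : ℕ → ℝ≥0}

lemma cartesianPart_smul (c : ℝ≥0∞) (μ : Measure (Fin d → ℝ≥0)) :
    cartesianPart (c • μ) = c • cartesianPart μ := by
  rw [cartesianPart, Measure.map_smul, Measure.comap_smul, cartesianPart]

lemma polarPart_smul (c : ℝ≥0∞) (μ : Measure (Fin d → ℝ≥0)) :
    polarPart N (c • μ) = c • polarPart N μ := by
  rw [polarPart, Measure.map_smul, Measure.comap_smul, polarPart]

lemma scaledLaw_eq_cartesianPart (hX : Measurable X) (n : ℕ) :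
    scaledLaw P X b n = cartesianPart ((n : ℝ≥0∞) • P.map fun ω => (b n)⁻¹ • X ω) := by
  rw [cartesianPart_smul, cartesianPart,
    Measure.map_map continuous_toExtended.measurable (by fun_prop), scaledLaw]
  congr! 4
  ext ω
  simp [toExtended, div_eq_inv_mul]

lemma scaledPolarLaw_eq_polarPart (hX : Measurable X) {n : ℕ} (hn : b n ≠ 0) :
    scaledPolarLaw P N X b n = polarPart N ((n : ℝ≥0∞) • P.map fun ω => (b n)⁻¹ • X ω) := by
  rw [polarPart_smul, polarPart, Measure.map_map measurable_toPolar (by fun_prop), scaledPolarLaw]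
  congr! 3
  ext1 ω
  rw [Function.comp_apply, toPolar, posDirection_smul (inv_ne_zero hn), posNorm_smul,
    div_eq_inv_mul, posDirection]

theorem hasAngularMeasure_of_tendstoAwayFrom (hN : IsNorm N) (hX : Measurable X) (hα : 0 < α)
    (hb : Tendsto b atTop atTop) {ν : Measure (Fin d → ℝ≥0)} (hν : ∀ U ∈ 𝓝 0, ν Uᶜ ≠ ∞)
    (hlim : TendstoAwayFrom 0 (fun n : ℕ => (n : ℝ≥0∞) • P.map fun ω => (b n)⁻¹ • X ω) atTop ν)
    {H : Measure (PosSphere N)} [IsFiniteMeasure H]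
    (hH : polarPart N ν = (powerMeasure α).prod H) : HasAngularMeasure P N X α b H := by
  refine ⟨hb, inferInstance, ⟨cartesianPart ν, ⟨isFiniteMeasureOnCompacts_cartesianPart hν, ?_⟩,
    fun C hC => ?_⟩, fun f hf hfc => ?_⟩
  · simpa only [VagueTendsto, scaledLaw_eq_cartesianPart hX] using hlim.vagueTendsto_cartesianPart
  · have hone : powerMeasure α {r | 1 ≤ r.1} = 1 := by
      simpa using powerMeasure_setOf_le hα one_pos
    rw [cartesianPart_outerCone ν hC, hH, Measure.prod_prod, hone, one_mul]
  · rw [← hH]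
    refine (hlim.vagueTendsto_polarPart hN f hf hfc).congr' ?_
    filter_upwards [hb.eventually_ne_atTop 0] with n hn
    rw [scaledPolarLaw_eq_polarPart hX hn]

lemma VagueTendsto.unique {E : Type*} [TopologicalSpace E] [T2Space E] [LocallyCompactSpace E]
    [SecondCountableTopology E] [MeasurableSpace E] [BorelSpace E] {μ : ℕ → Measure E}
    {ν₁ ν₂ : Measure E} [IsFiniteMeasureOnCompacts ν₁] [IsFiniteMeasureOnCompacts ν₂]
    (h₁ : VagueTendsto μ ν₁) (h₂ : VagueTendsto μ ν₂) : ν₁ = ν₂ :=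
  Measure.ext_of_integral_eq_on_compactlySupported fun f =>
    tendsto_nhds_unique (h₁ f f.continuous f.hasCompactSupport)
      (h₂ f f.continuous f.hasCompactSupport)

lemma HasAngularMeasure.unique {H₁ H₂ : Measure (PosSphere N)}
    (h₁ : HasAngularMeasure P N X α b H₁) (h₂ : HasAngularMeasure P N X α b H₂) : H₁ = H₂ := by
  obtain ⟨-, -, ⟨ν₁, ⟨_, hν₁⟩, hH₁⟩, -⟩ := h₁
  obtain ⟨-, -, ⟨ν₂, ⟨_, hν₂⟩, hH₂⟩, -⟩ := h₂
  have : LocallyCompactSpace (Punctured d) :=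
    (isOpen_compl_singleton (x := (0 : Fin d → ℝ≥0∞))).locallyCompactSpace
  have : SecondCountableTopology (Punctured d) :=
    TopologicalSpace.Subtype.secondCountableTopology {x : Fin d → ℝ≥0∞ | x ≠ 0}
  ext C hC
  rw [hH₁ C hC, hH₂ C hC, hν₁.unique hν₂]

end AngularMeasure

section LinearImages

variable {d : ℕ} {ι : Type*} [Fintype ι] {α : ℝ}

lemma map_mulVec_axisMeasure [DecidableEq ι] (A : Matrix (Fin d) ι ℝ≥0) (α : ℝ) :
    (axisMeasure fun _ : ι => tailMeasure α).map (A *ᵥ ·) = raysMeasure A.col α := by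
  have hA : Measurable (A *ᵥ · : (ι → ℝ≥0) → Fin d → ℝ≥0) :=
    (by fun_prop : Continuous _).measurable
  rw [axisMeasure, Measure.map_finset_sum' hA.aemeasurable, raysMeasure]
  refine Finset.sum_congr rfl fun j _ => ?_
  rw [Measure.map_map hA (measurable_single j)]
  congr! 1
  ext x : 1
  exact (Matrix.mulVec_single A j x).trans (op_smul_eq_smul x _)

theorem tendstoAwayFrom_mulVec {Ω : Type*} [MeasurableSpace Ω] {P : Measure Ω}
    [IsProbabilityMeasure P] (A : Matrix (Fin d) ι ℝ≥0) (hα : 0 < α) {Z : Ω → ι → ℝ≥0}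
    (hZ : Measurable Z) (hindep : iIndepFun (fun i ω => Z ω i) P) {b : ℕ → ℝ≥0}
    (hstd : ∀ i (z : ℝ≥0), 0 < z →
      Tendsto (fun n : ℕ => n * P.real {ω | z < (b n)⁻¹ * Z ω i}) atTop (𝓝 (z ^ (-α) : ℝ≥0))) :
    TendstoAwayFrom 0 (fun n : ℕ => (n : ℝ≥0∞) • P.map fun ω => (b n)⁻¹ • (A *ᵥ Z ω)) atTop
      (raysMeasure A.col α) := by
  classical
  have hA : Continuous (A *ᵥ · : (ι → ℝ≥0) → Fin d → ℝ≥0) := by fun_prop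
  have hcoord (n : ℕ) (i : ι) : Measurable fun ω => (b n)⁻¹ * Z ω i := by fun_prop
  have : ∀ n i, IsProbabilityMeasure (P.map fun ω => (b n)⁻¹ * Z ω i) := fun n i =>
    Measure.isProbabilityMeasure_map (hcoord n i).aemeasurable
  have hjoint (n : ℕ) : Measure.pi (fun i => P.map fun ω => (b n)⁻¹ * Z ω i) =
      P.map fun ω => (b n)⁻¹ • Z ω :=
    ((iIndepFun_iff_map_fun_eq_pi_map fun i => (hcoord n i).aemeasurable).1
      (hindep.comp (fun _ x => (b n)⁻¹ * x) fun _ => by fun_prop)).symm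
  have hlim : TendstoAwayFrom 0 (fun n : ℕ => (n : ℝ≥0∞) • P.map fun ω => (b n)⁻¹ • Z ω) atTop
      (axisMeasure fun _ => tailMeasure α) := by
    simp only [← hjoint]
    refine tendstoAwayFrom_pi (fun _ _ => tailMeasure_Ioi_ne_top hα) fun i z hz => ?_
    simp only [map_measureReal_apply (hcoord _ i) measurableSet_Ioi, tailMeasure_real_Ioi hα hz]
    exact hstd i z hz
  have hscaled (n : ℕ) : Measurable fun ω => (b n)⁻¹ • Z ω := by fun_prop
  simpa only [Measure.map_smul, Measure.map_map hA.measurable (hscaled _), Function.comp_def,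
    Matrix.mulVec_smul, Matrix.mulVec_zero, map_mulVec_axisMeasure] using hlim.map hA

theorem hasAngularMeasure_mulVec {Ω : Type*} [MeasurableSpace Ω] {P : Measure Ω}
    [IsProbabilityMeasure P] (A : Matrix (Fin d) ι ℝ≥0) (hα : 0 < α) {Z : Ω → ι → ℝ≥0}
    (hZ : Measurable Z) (hindep : iIndepFun (fun i ω => Z ω i) P) {b : ℕ → ℝ≥0}
    (hb : Tendsto b atTop atTop)
    (hstd : ∀ i (z : ℝ≥0), 0 < z →
      Tendsto (fun n : ℕ => n * P.real {ω | z < (b n)⁻¹ * Z ω i}) atTop (𝓝 (z ^ (-α) : ℝ≥0)))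
    {N : Seminorm ℝ (Fin d → ℝ)} (hN : IsNorm N) :
    HasAngularMeasure P N (fun ω => A *ᵥ Z ω) α b (discreteAngularMeasure N A.col α) :=
  hasAngularMeasure_of_tendstoAwayFrom hN
    ((by fun_prop : Continuous (A *ᵥ · : (ι → ℝ≥0) → Fin d → ℝ≥0)).measurable.comp hZ) hα hb
    (fun _ hU => raysMeasure_compl_ne_top hα A.col hU) (tendstoAwayFrom_mulVec A hα hZ hindep hstd)
    (polarPart_raysMeasure hα A.col)

lemma tendsto_natCast_rpow_one_div_atTop (hα : 0 < α) :
    Tendsto (fun n : ℕ => (n : ℝ≥0) ^ (1 / α)) atTop atTop := by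
  rw [← NNReal.tendsto_coe_atTop]
  exact (tendsto_rpow_atTop (one_div_pos.2 hα)).comp tendsto_natCast_atTop_atTop

lemma IsStandardised.tendsto_measureReal {Ω : Type*} [MeasurableSpace Ω] {P : Measure Ω}
    {Z : Ω → Fin d → ℝ≥0} (h : IsStandardised P Z α) (i : Fin d) (z : ℝ≥0) (hz : 0 < z) :
    Tendsto (fun n : ℕ => n * P.real {ω | z < ((n : ℝ≥0) ^ (1 / α))⁻¹ * Z ω i}) atTop
      (𝓝 (z ^ (-α) : ℝ≥0)) := by
  simpa only [← NNReal.coe_lt_coe, NNReal.coe_mul, NNReal.coe_inv, NNReal.coe_rpow,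
    NNReal.coe_natCast, ← Real.rpow_neg (Nat.cast_nonneg _)] using h i z hz

end LinearImages

end MRV

theorem mainTheorem4_general {Ω : Type*} [MeasurableSpace Ω] (P : Measure Ω)
    [IsProbabilityMeasure P] {d : ℕ} {ι : Type*} [Fintype ι] (A : Matrix (Fin d) ι ℝ≥0) (α : ℝ)
    (hα : 0 < α) (Z : Ω → ι → ℝ≥0) (hZ : Measurable Z)
    (hindep : iIndepFun (fun (i : ι) (ω : Ω) => Z ω i) P) (b : ℕ → ℝ≥0)
    (hb : Tendsto b atTop atTop)
    (hstd : ∀ i (z : ℝ≥0), 0 < z →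
      Tendsto (fun n : ℕ => n * P.real {ω | z < (b n)⁻¹ * Z ω i}) atTop (𝓝 (z ^ (-α) : ℝ≥0))) :
    (A ≠ 0 → MRV.IsRegularlyVarying P (fun ω => A *ᵥ Z ω) α) ∧
    ∀ N : Seminorm ℝ (Fin d → ℝ), MRV.IsNorm N →
      MRV.HasAngularMeasure P N (fun ω => A *ᵥ Z ω) α b (MRV.discreteAngularMeasure N A.col α) ∧
      ∀ H : Measure (MRV.PosSphere N), MRV.HasAngularMeasure P N (fun ω => A *ᵥ Z ω) α b H →
        H = MRV.discreteAngularMeasure N A.col α := by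
  have hang (N : Seminorm ℝ (Fin d → ℝ)) (hN : MRV.IsNorm N) :=
    MRV.hasAngularMeasure_mulVec A hα hZ hindep hb hstd hN
  refine ⟨fun hA => ⟨hα, fun N hN => ⟨b, _, ?_, hang N hN⟩⟩,
    fun N hN => ⟨hang N hN, fun H hH => hH.unique (hang N hN)⟩⟩
  exact MRV.discreteAngularMeasure_ne_zero hN fun h =>
    hA (Matrix.ext fun i j => congrFun (congrFun h j) i)

theorem mainTheorem4 {Ω : Type*} [MeasurableSpace Ω] (P : Measure Ω) [IsProbabilityMeasure P]
    {d : ℕ} (A : Matrix (Fin d) (Fin d) ℝ≥0) (α : ℝ) (Z : Ω → Fin d → ℝ≥0)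
    (hZ_meas : Measurable Z)
    (hZ_rv : MRV.IsRegularlyVarying P Z α)
    (hZ_indep : iIndepFun (fun (i : Fin d) (ω : Ω) => Z ω i) P)
    (hZ_std : MRV.IsStandardised P Z α) :
    (A ≠ 0 → MRV.IsRegularlyVarying P (fun ω => A *ᵥ Z ω) α) ∧
    ∀ N : Seminorm ℝ (Fin d → ℝ), MRV.IsNorm N →
      MRV.HasAngularMeasure P N (fun ω => A *ᵥ Z ω) α (fun n => (n : ℝ≥0) ^ (1 / α))
        (MRV.columnAngularMeasure N A α) ∧
      ∀ H : Measure (MRV.PosSphere N),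
        MRV.HasAngularMeasure P N (fun ω => A *ᵥ Z ω) α (fun n => (n : ℝ≥0) ^ (1 / α)) H →
          H = MRV.columnAngularMeasure N A α :=
  mainTheorem4_general P A α hZ_rv.1 Z hZ_meas hZ_indep _
    (MRV.tendsto_natCast_rpow_one_div_atTop hZ_rv.1) hZ_std.tendsto_measureReal
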